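/- **Proposition 5.3 (Monotone convergence of local martingales).** Let $0\le T<\infty$ and let $(\Omega,\mathcal F,(\mathcal F_t)_{0\le t\le T},P)$ be a filtered probability space satisfying the usual assumptions (the filtration is right-continuous, and $\mathcal F_0$ contains every $P$-null set, i.e. every subset of a set $N\in\mathcal F$ with $P(N)=0$). A *local martingale* on $[0,T]$ is a real-valued adapted process $X=(X_t)_{0\le t\le T}$ with almost surely càdlàg paths for which there exist stopping times $\tau_k$ with values in $[0,T]\cup\{\infty\}$, almost surely increasing to $\infty$ (so that almost surely $\tau_k=\infty$ for all large $k$), such that for each $k$ the stopped process $(X_{t\wedge\tau_k})_{0\le t\le T}$ is a martingale. Let $(M^n_t)_{0\le t\le T}$, $n\in\mathbb N$, be a sequence of local martingales such that, for all $t\in[0,T]$ and all $n$, $M^{n+1}_t\ge M^n_t\ge 0$ almost surely. Let $(M_t)_{0\le t\le T}$ be real-valued with $M^n_t\to M_t$ almost surely, for every $t\in[0,T]$, and suppose that $E[M_0]<\infty$. Then $M$ has a càdlàg modification, that is, a process $Y$ with almost surely càdlàg paths such that $Y_t=M_t$ almost surely for every $t\in[0,T]$, and every such modification $Y$ is a local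 martingale with respect to $(\mathcal F_t)_{0\le t\le T}$ and $P$. -/

import Mathlib

open MeasureTheory ProbabilityTheory Filter Topology
open scoped NNReal

/-- The time interval `[0, T]`, as a subtype of the nonnegative reals. Its least element `⊥` is
the time `0`. -/
abbrev TimeInterval (T : ℝ≥0) : Type := Set.Iic T

/-- A path on `[0, T]` is càdlàg: right-continuous at every time, with a finite left limit at
every time (the condition on left limits is void at time `0`). -/
def IsCadlagPath {T : ℝ≥0} (f : TimeInterval T → ℝ) : Prop :=
  ∀ t, ContinuousWithinAt f (Set.Ici t) t ∧ ∃ l : ℝ, Tendsto f (𝓝[<] t) (𝓝 l)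

/-- A process on `[0, T]` has càdlàg paths almost surely. -/
def IsCadlagProcess {T : ℝ≥0} {Ω : Type*} {mΩ : MeasurableSpace Ω}
    (X : TimeInterval T → Ω → ℝ) (P : Measure Ω) : Prop :=
  ∀ᵐ ω ∂P, IsCadlagPath (fun t => X t ω)

/-- The usual assumptions on a filtered probability space: the filtration is right-continuous,
and every `P`-null set belongs to `𝓕 0` (here `P s` is the outer measure of an arbitrary set `s`,
so that completeness of the probability space is included). -/
structure UsualAssumptions {T : ℝ≥0} {Ω : Type*} {mΩ : MeasurableSpace Ω}
    (𝓕 : Filtration (TimeInterval T) mΩ) (P : Measure Ω) : Prop where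
  rightContinuous : 𝓕.IsRightContinuous
  null_measurableSet : ∀ s : Set Ω, P s = 0 → MeasurableSet[𝓕 ⊥] s

/-- A local martingale on `[0, T]`: an adapted, almost surely càdlàg process `X` for which there
are stopping times `τ k` with values in `[0, T] ∪ {∞}`, almost surely increasing to `∞`, such that
every stopped process `X^(τ k)` is a martingale. In `WithTop (TimeInterval T)` the point `⊤` (that
is, `∞`) is isolated, so convergence to it means that `τ k = ∞` for all large `k`. -/
def IsLocalMartingale {T : ℝ≥0} {Ω : Type*} {mΩ : MeasurableSpace Ω}
    (X : TimeInterval T → Ω → ℝ) (𝓕 : Filtration (TimeInterval T) mΩ) (P : Measure Ω) : Prop :=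
  StronglyAdapted 𝓕 X ∧ IsCadlagProcess X P ∧
    ∃ τ : ℕ → Ω → WithTop (TimeInterval T),
      IsLocalizingSequence 𝓕 τ P ∧ ∀ k, Martingale (stoppedProcess X (τ k)) 𝓕 P

/-- `Y` is a càdlàg modification (version) of `X`. -/
def IsCadlagModification {T : ℝ≥0} {Ω : Type*} {mΩ : MeasurableSpace Ω}
    (Y X : TimeInterval T → Ω → ℝ) (P : Measure Ω) : Prop :=
  IsCadlagProcess Y P ∧ ∀ t, Y t =ᵐ[P] X t

/-! Convergence at time 0 controls the whole path. For `m ≤ n` the difference `M n - M m` is a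
nonnegative local martingale (`IsLocalMartingale.sub`), so Doob's inequality
(`IsLocalMartingale.measure_exists_lt_le`) bounds the probability that it ever exceeds `ε` by `E[M n
0 - M m 0] / ε`. As `E[M_0] < ∞`, these gaps tend to 0; along a fast subsequence Borel–Cantelli
gives almost sure uniform convergence on `[0, T]` (`exists_subseq_ae_tendstoUniformly`), and uniform
limits of càdlàg paths are càdlàg.

The limit `Y` is localized by its own exceedance times (`isLocalMartingale_of_tendsto`). Fatou gives
`E[Y_ρ] ≤ E[Y_0]` at every stopping time `ρ`. Up to the exceedance time of level `k`, every `M n` is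
dominated by `k` plus the value of `Y` at that time (or at `T`), which is integrable. Hence `E[M n
ρ] = E[M n 0]` for `ρ` before that time, and `Y ≥ M n` yields the reverse inequality. Constant
expectation at all stopping times characterizes martingales
(`martingale_of_forall_integral_comp_eq`). -/

/-! ### Approximation of times from above by a countable grid -/

/-- The smallest multiple of `1 / (j + 1)` that is at least `t`, cut off at `T`. -/
noncomputable def gridAbove {T : ℝ≥0} (j : ℕ) (t : TimeInterval T) : TimeInterval T :=
  ⟨min (⌈((j : ℝ≥0) + 1) * t⌉₊ / ((j : ℝ≥0) + 1)) T, Set.mem_Iic.2 (min_le_right _ _)⟩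

section Grid

variable {T : ℝ≥0}

lemma le_gridAbove (j : ℕ) (t : TimeInterval T) : t ≤ gridAbove j t := by
  rw [← Subtype.coe_le_coe]
  refine le_min ?_ (Set.mem_Iic.1 t.2)
  rw [le_div_iff₀ (by positivity), mul_comm]
  exact Nat.le_ceil _

lemma countable_range_gridAbove (j : ℕ) : (Set.range (gridAbove (T := T) j)).Countable := by
  refine (Set.countable_range
    (fun n : ℕ => (⟨min (n / ((j : ℝ≥0) + 1)) T, Set.mem_Iic.2 (min_le_right _ _)⟩ : TimeInterval T))).mono ?_
  rintro _ ⟨t, rfl⟩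
  exact ⟨_, rfl⟩

lemma tendsto_gridAbove (t : TimeInterval T) :
    Tendsto (fun j => gridAbove j t) atTop (𝓝[≥] t) := by
  refine tendsto_nhdsWithin_iff.2 ⟨?_, Eventually.of_forall fun j => le_gridAbove j t⟩
  rw [tendsto_subtype_rng]
  have h1 : Tendsto (fun j : ℕ => (t : ℝ≥0) + 1 / ((j : ℝ≥0) + 1)) atTop (𝓝 ((t : ℝ≥0) + 0)) :=
    tendsto_const_nhds.add tendsto_one_div_add_atTop_nhds_zero_nat
  rw [add_zero] at h1
  refine tendsto_of_tendsto_of_tendsto_of_le_of_le tendsto_const_nhds h1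
    (fun j => le_gridAbove j t) fun j => (min_le_left _ _).trans ?_
  have hj : (0 : ℝ≥0) < (j : ℝ≥0) + 1 := by positivity
  have hj' : ((t : ℝ≥0) + 1 / ((j : ℝ≥0) + 1)) * ((j : ℝ≥0) + 1) = ((j : ℝ≥0) + 1) * t + 1 := by
    field_simp
  rw [div_le_iff₀ hj, hj']
  exact (Nat.ceil_lt_add_one (by positivity)).le

/-- Here `v` is `u` rounded down to the grid. This is what makes a stopping time rounded up to the
grid a stopping time again. Below `T` the cut-off plays no role. -/
lemma gridAbove_le_iff (j : ℕ) {u : TimeInterval T} (hu : u < ⊤) :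
    ∃ v ≤ u, ∀ t : TimeInterval T, gridAbove j t ≤ u ↔ t ≤ v := by
  have hj : (0 : ℝ≥0) < (j : ℝ≥0) + 1 := by positivity
  have hv : ((⌊((j : ℝ≥0) + 1) * u⌋₊ : ℝ≥0) / ((j : ℝ≥0) + 1)) ≤ u := by
    rw [div_le_iff₀ hj, mul_comm]
    exact Nat.floor_le (by positivity)
  refine ⟨⟨_, Set.mem_Iic.2 (hv.trans (Set.mem_Iic.1 u.2))⟩, hv, fun t => ?_⟩
  have hu' : ¬ T ≤ (u : ℝ≥0) := not_le.2 hu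
  rw [← Subtype.coe_le_coe, ← Subtype.coe_le_coe]
  simp only [gridAbove, min_le_iff, hu', or_false]
  rw [div_le_iff₀ hj, le_div_iff₀ hj, mul_comm (u : ℝ≥0), mul_comm (t : ℝ≥0),
    ← Nat.le_floor_iff (by positivity), Nat.ceil_le]

variable (T) in
/-- The countable set of all grid points. -/
def gridPoints : Set (TimeInterval T) := ⋃ j, Set.range (gridAbove (T := T) j)

lemma countable_gridPoints : (gridPoints T).Countable :=
  Set.countable_iUnion countable_range_gridAbove

lemma gridAbove_mem_gridPoints (j : ℕ) (t : TimeInterval T) : gridAbove j t ∈ gridPoints T :=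
  Set.mem_iUnion.2 ⟨j, t, rfl⟩

lemma IsCadlagPath.tendsto_gridAbove {f : TimeInterval T → ℝ} (hf : IsCadlagPath f)
    (t : TimeInterval T) : Tendsto (fun j => f (gridAbove j t)) atTop (𝓝 (f t)) :=
  (hf t).1.tendsto.comp (_root_.tendsto_gridAbove t)

lemma IsCadlagPath.le_of_forall_gridPoints {f g : TimeInterval T → ℝ} (hf : IsCadlagPath f)
    (hg : IsCadlagPath g) (h : ∀ t ∈ gridPoints T, f t ≤ g t) (t : TimeInterval T) : f t ≤ g t :=
  le_of_tendsto_of_tendsto' (hf.tendsto_gridAbove t) (hg.tendsto_gridAbove t)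
    fun j => h _ (gridAbove_mem_gridPoints j t)

/-! ### Càdlàg paths -/

lemma isCadlagPath_const (c : ℝ) : IsCadlagPath (fun _ : TimeInterval T => c) :=
  fun _ => ⟨continuousWithinAt_const, c, tendsto_const_nhds⟩

lemma IsCadlagPath.sub {f g : TimeInterval T → ℝ} (hf : IsCadlagPath f) (hg : IsCadlagPath g) :
    IsCadlagPath (fun t => f t - g t) := fun t => by
  obtain ⟨hf1, l, hl⟩ := hf t
  obtain ⟨hg1, m, hm⟩ := hg t
  exact ⟨hf1.sub hg1, l - m, hl.sub hm⟩

lemma TimeInterval.isCompact_univ : IsCompact (Set.univ : Set (TimeInterval T)) := by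
  have : IsCompact (Set.Iic T) := by
    rw [← Set.Icc_bot]
    exact isCompact_Icc
  exact isCompact_iff_isCompact_univ.1 this

/-- Right-continuity and the left limit bound the path near each time; compactness of `[0, T]` does
the rest. -/
lemma IsCadlagPath.bddAbove {f : TimeInterval T → ℝ} (hf : IsCadlagPath f) :
    ∃ C, ∀ t, f t ≤ C := by
  suffices h : ∃ C, ∀ t ∈ Set.univ, f t ≤ C by simpa using h
  refine TimeInterval.isCompact_univ.induction_on (p := fun s => ∃ C, ∀ t ∈ s, f t ≤ C) ⟨0, by simp⟩
    (fun s t hst ⟨C, hC⟩ => ⟨C, fun x hx => hC x (hst hx)⟩) ?_ ?_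
  · rintro s t ⟨C, hC⟩ ⟨D, hD⟩
    refine ⟨max C D, fun x hx => ?_⟩
    rcases hx with hx | hx
    · exact (hC x hx).trans (le_max_left _ _)
    · exact (hD x hx).trans (le_max_right _ _)
  · intro t _
    obtain ⟨h1, l, h2⟩ := hf t
    have e1 := h1.tendsto.eventually (eventually_le_nhds (lt_add_one (f t)))
    have e2 := h2.eventually (eventually_le_nhds (lt_add_one l))
    refine ⟨{x | f x ≤ max (f t + 1) (l + 1)}, ?_, _, fun _ h => h⟩
    rw [nhdsWithin_univ, ← nhdsLT_sup_nhdsGE t]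
    exact ⟨e2.mono fun x hx => hx.trans (le_max_right _ _),
      e1.mono fun x hx => hx.trans (le_max_left _ _)⟩

lemma IsCadlagPath.of_tendstoUniformly {F : ℕ → TimeInterval T → ℝ} {f : TimeInterval T → ℝ}
    (hF : ∀ n, IsCadlagPath (F n)) (h : TendstoUniformly F f atTop) : IsCadlagPath f := by
  intro t
  constructor
  · have h1 : TendstoUniformlyOnFilter F f atTop (𝓝[≥] t) :=
      h.tendstoUniformlyOnFilter.mono_right le_top
    exact h1.tendsto_of_eventually_tendsto (Eventually.of_forall fun n => (hF n t).1)
      (h.tendsto_at t)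
  · rcases eq_or_neBot (𝓝[<] t) with h0 | h0
    -- With no times to the left, any value serves as left limit.
    · exact ⟨0, by simp [h0]⟩
    choose l hl using fun n => (hF n t).2
    have hc : CauchySeq l := by
      rw [Metric.cauchySeq_iff]
      intro ε hε
      obtain ⟨N, hN⟩ := eventually_atTop.1
        (Metric.tendstoUniformly_iff.1 h (ε / 4) (by positivity))
      refine ⟨N, fun m hm n hn => ?_⟩
      have : dist (l m) (l n) ≤ ε / 2 := by
        refine le_of_tendsto ((hl m).dist (hl n)) (Eventually.of_forall fun x => ?_)
        have := dist_triangle_left (F m x) (F n x) (f x)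
        linarith [hN m hm x, hN n hn x]
      linarith
    obtain ⟨L, hL⟩ := cauchySeq_tendsto_of_complete hc
    have h1 : TendstoUniformlyOnFilter F f atTop (𝓝[<] t) :=
      h.tendstoUniformlyOnFilter.mono_right le_top
    exact ⟨L, h1.tendsto_of_eventually_tendsto (Eventually.of_forall hl) hL⟩

end Grid

/-! ### Almost sure comparison of càdlàg processes -/

section StoppingTimes

variable {T : ℝ≥0} {Ω : Type*} {mΩ : MeasurableSpace Ω} {P : Measure Ω}
  {𝓕 : Filtration (TimeInterval T) mΩ} {X Y : TimeInterval T → Ω → ℝ}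

/-- The null set may depend on `t`; a countable union over the grid and right-continuity make it
uniform. -/
lemma IsCadlagProcess.ae_le (hX : IsCadlagProcess X P) (hY : IsCadlagProcess Y P)
    (h : ∀ t, ∀ᵐ ω ∂P, X t ω ≤ Y t ω) : ∀ᵐ ω ∂P, ∀ t, X t ω ≤ Y t ω := by
  have h' : ∀ᵐ ω ∂P, ∀ t ∈ gridPoints T, X t ω ≤ Y t ω :=
    (ae_ball_iff countable_gridPoints).2 fun t _ => h t
  filter_upwards [hX, hY, h'] with ω h1 h2 h3 using h1.le_of_forall_gridPoints h2 h3

lemma IsCadlagProcess.ae_nonneg (hX : IsCadlagProcess X P)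
    (h : ∀ t, ∀ᵐ ω ∂P, 0 ≤ X t ω) : ∀ᵐ ω ∂P, ∀ t, 0 ≤ X t ω :=
  IsCadlagProcess.ae_le (ae_of_all _ fun _ => isCadlagPath_const 0) hX h

/-! ### Stopping times with values in `[0, T]` -/

/-- A stopping time with values in `[0, T]`. -/
abbrev IsFiniteStoppingTime (𝓕 : Filtration (TimeInterval T) mΩ) (σ : Ω → TimeInterval T) : Prop :=
  IsStoppingTime 𝓕 (fun ω => (σ ω : WithTop (TimeInterval T)))

lemma IsFiniteStoppingTime.gridAbove {σ : Ω → TimeInterval T} (hσ : IsFiniteStoppingTime 𝓕 σ)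
    (j : ℕ) : IsFiniteStoppingTime 𝓕 (fun ω => gridAbove j (σ ω)) := by
  intro u
  simp only [WithTop.coe_le_coe]
  rcases eq_or_lt_of_le (le_top : u ≤ ⊤) with rfl | hu
  · simp
  · obtain ⟨v, hvu, hv⟩ := gridAbove_le_iff j hu
    simp only [hv]
    simpa using 𝓕.mono hvu _ (hσ v)

/-- The time `t` cut off at `τ`. -/
noncomputable def capTime (τ : WithTop (TimeInterval T)) (t : TimeInterval T) : TimeInterval T :=
  (min (t : WithTop (TimeInterval T)) τ).untopA

@[simp] lemma coe_capTime (τ : WithTop (TimeInterval T)) (t : TimeInterval T) :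
    (capTime τ t : WithTop (TimeInterval T)) = min (t : WithTop (TimeInterval T)) τ := by
  unfold capTime
  -- The minimum is at most `t`, so the default value of `untopA` never occurs.
  rw [WithTop.untopA_eq_untop (by simp)]
  simp

lemma stoppedProcess_eq_capTime (τ : Ω → WithTop (TimeInterval T)) (t : TimeInterval T) (ω : Ω) :
    stoppedProcess X τ t ω = X (capTime (τ ω) t) ω := rfl

lemma capTime_le (τ : WithTop (TimeInterval T)) (t : TimeInterval T) : capTime τ t ≤ t := by
  rw [← WithTop.coe_le_coe, coe_capTime]; exact min_le_left _ _

@[simp] lemma capTime_top (t : TimeInterval T) : capTime ⊤ t = t := by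
  rw [← WithTop.coe_inj, coe_capTime]; simp

lemma capTime_eq_self {τ : WithTop (TimeInterval T)} {t : TimeInterval T} (h : ↑t ≤ τ) :
    capTime τ t = t := by
  rw [← WithTop.coe_inj, coe_capTime]; simp [h]

@[simp] lemma capTime_bot (τ : WithTop (TimeInterval T)) : capTime τ ⊥ = ⊥ :=
  capTime_eq_self (by simp)

lemma MeasureTheory.IsStoppingTime.capTime {τ : Ω → WithTop (TimeInterval T)}
    (hτ : IsStoppingTime 𝓕 τ) {σ : Ω → TimeInterval T} (hσ : IsFiniteStoppingTime 𝓕 σ) :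
    IsFiniteStoppingTime 𝓕 (fun ω => capTime (τ ω) (σ ω)) := by
  simpa only [IsFiniteStoppingTime, coe_capTime] using hσ.min hτ

lemma isFiniteStoppingTime_const (t : TimeInterval T) : IsFiniteStoppingTime 𝓕 (fun _ => t) :=
  isStoppingTime_const 𝓕 t

/-! ### Measurability -/

/-- The set where `f` and `g` differ, and all its subsets, lie in `𝓕 ⊥`. -/
lemma UsualAssumptions.measurable_of_ae_eq (h : UsualAssumptions 𝓕 P) {t : TimeInterval T}
    {f g : Ω → ℝ} (hf : Measurable[𝓕 t] f) (hfg : f =ᵐ[P] g) : Measurable[𝓕 t] g := by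
  intro s hs
  have hnull : ∀ N : Set Ω, P N = 0 → MeasurableSet[𝓕 t] N := fun N hN =>
    𝓕.mono bot_le _ (h.null_measurableSet N hN)
  have h0 : P {ω | f ω ≠ g ω} = 0 := hfg
  have : g ⁻¹' s = (f ⁻¹' s ∩ {ω | f ω ≠ g ω}ᶜ) ∪ (g ⁻¹' s ∩ {ω | f ω ≠ g ω}) := by
    ext ω
    by_cases hω : f ω = g ω <;> simp [hω]
  rw [this]
  exact ((hf hs).inter (hnull _ h0).compl).union
    (hnull _ (measure_mono_null Set.inter_subset_right h0))

lemma UsualAssumptions.measurable_of_tendsto_ae (h : UsualAssumptions 𝓕 P) {t : TimeInterval T}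
    {f : ℕ → Ω → ℝ} {g : Ω → ℝ} (hf : ∀ n, Measurable[𝓕 t] (f n))
    (hfg : ∀ᵐ ω ∂P, Tendsto (fun n => f n ω) atTop (𝓝 (g ω))) : Measurable[𝓕 t] g := by
  let A : Set Ω := {ω | Tendsto (fun n => f n ω) atTop (𝓝 (g ω))}
  have hA : MeasurableSet[𝓕 t] A := by
    have := (𝓕.mono bot_le _ (h.null_measurableSet Aᶜ hfg) : MeasurableSet[𝓕 t] Aᶜ)
    simpa using this.compl
  refine h.measurable_of_ae_eq (f := A.indicator g) ?_ ?_
  · refine @measurable_of_tendsto_metrizable Ω ℝ (𝓕 t) _ _ _ _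
      (fun n => A.indicator (f n)) _ (fun n => (hf n).indicator hA) ?_
    rw [tendsto_pi_nhds]
    intro ω
    by_cases hω : ω ∈ A
    · simp only [Set.indicator_of_mem hω]
      exact hω
    · simp [hω]
  · filter_upwards [hfg] with ω hω
    exact Set.indicator_of_mem (s := A) hω g

lemma measurable_comp_of_countable_range {m : MeasurableSpace Ω} {σ : Ω → TimeInterval T}
    (hc : (Set.range σ).Countable) (hσ : ∀ v, MeasurableSet {ω | σ ω = v})
    (hX : ∀ ω, Measurable (X (σ ω))) : Measurable (fun ω => X (σ ω) ω) := by
  intro s hs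
  have : (fun ω => X (σ ω) ω) ⁻¹' s = ⋃ v ∈ Set.range σ, ({ω | σ ω = v} ∩ X v ⁻¹' s) := by
    ext ω
    simp only [Set.mem_preimage, Set.mem_iUnion, Set.mem_inter_iff, Set.mem_ofPred_eq]
    exact ⟨fun h => ⟨_, ⟨ω, rfl⟩, rfl, h⟩, fun ⟨_, _, h1, h2⟩ => h1 ▸ h2⟩
  rw [this]
  refine MeasurableSet.biUnion hc ?_
  rintro _ ⟨ω, rfl⟩
  exact (hσ _).inter (hX ω hs)

lemma IsFiniteStoppingTime.measurableSet_eq_of_le {σ : Ω → TimeInterval T}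
    (hσ : IsFiniteStoppingTime 𝓕 σ) {t : TimeInterval T} (hle : ∀ ω, σ ω ≤ t) (v : TimeInterval T) :
    MeasurableSet[𝓕 t] {ω | σ ω = v} := by
  by_cases hv : v ≤ t
  · have := 𝓕.mono hv _ (hσ.measurableSet_eq v)
    simpa using this
  · have : {ω | σ ω = v} = ∅ := by
      ext ω
      simp only [Set.mem_ofPred_eq, Set.mem_empty_iff_false, iff_false]
      rintro rfl
      exact hv (hle ω)
    rw [this]
    exact @MeasurableSet.empty _ (𝓕 t)

/-- The value of an adapted càdlàg process at a stopping time bounded by `t` is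
`𝓕 t`-measurable. -/
lemma UsualAssumptions.measurable_comp (h : UsualAssumptions 𝓕 P) (hX : StronglyAdapted 𝓕 X)
    (hc : IsCadlagProcess X P) {σ : Ω → TimeInterval T} (hσ : IsFiniteStoppingTime 𝓕 σ)
    {t : TimeInterval T} (hle : ∀ ω, σ ω ≤ t) : Measurable[𝓕 t] (fun ω => X (σ ω) ω) := by
  -- Rounding up may overshoot `t`, so the approximation is cut off at `t` to remain `𝓕
  -- t`-measurable.
  refine h.measurable_of_tendsto_ae (f := fun j ω => X (min (gridAbove j (σ ω)) t) ω)
    (fun j => ?_) ?_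
  · have hs : IsFiniteStoppingTime 𝓕 (fun ω => min (gridAbove j (σ ω)) t) := by
      simpa [IsFiniteStoppingTime] using (hσ.gridAbove j).min (isFiniteStoppingTime_const t)
    refine @measurable_comp_of_countable_range T Ω X (𝓕 t) _ ?_
      (hs.measurableSet_eq_of_le fun ω => min_le_right _ _)
      fun ω => ((hX _).mono (𝓕.mono (min_le_right _ _))).measurable
    refine ((countable_range_gridAbove j).image (fun s => min s t)).mono ?_
    rintro _ ⟨ω, rfl⟩
    exact ⟨_, ⟨_, rfl⟩, rfl⟩
  · filter_upwards [hc] with ω hω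
    refine (hω (σ ω)).1.tendsto.comp (tendsto_nhdsWithin_iff.2 ⟨?_, Eventually.of_forall
      fun j => le_min (le_gridAbove j _) (hle ω)⟩)
    have h1 := ((tendsto_gridAbove (σ ω)).mono_right nhdsWithin_le_nhds).min
      (tendsto_const_nhds (x := t))
    rwa [min_eq_left (hle ω)] at h1

lemma UsualAssumptions.stronglyAdapted_stoppedProcess (h : UsualAssumptions 𝓕 P)
    (hX : StronglyAdapted 𝓕 X) (hc : IsCadlagProcess X P) {τ : Ω → WithTop (TimeInterval T)}
    (hτ : IsStoppingTime 𝓕 τ) : StronglyAdapted 𝓕 (stoppedProcess X τ) := fun t =>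
  (h.measurable_comp hX hc (hτ.capTime (isFiniteStoppingTime_const t))
    fun _ => capTime_le _ _).stronglyMeasurable

end StoppingTimes

/-! ### Stopped càdlàg paths and Fatou's lemma -/

section Stopped

variable {T : ℝ≥0}

lemma IsCadlagPath.capTime {f : TimeInterval T → ℝ} (hf : IsCadlagPath f)
    (τ : WithTop (TimeInterval T)) : IsCadlagPath (fun t => f (capTime τ t)) := by
  intro t
  rcases lt_or_ge (t : WithTop (TimeInterval T)) τ with h | h
  · have he : (fun t => f (_root_.capTime τ t)) =ᶠ[𝓝 t] f := by
      have : ∀ᶠ s : TimeInterval T in 𝓝 t, (s : WithTop (TimeInterval T)) ≤ τ := by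
        rcases eq_or_ne τ ⊤ with rfl | hτ
        · simp
        · lift τ to TimeInterval T using hτ
          simp only [WithTop.coe_le_coe]
          exact eventually_le_nhds (WithTop.coe_lt_coe.1 h)
      filter_upwards [this] with s hs
      rw [capTime_eq_self hs]
    obtain ⟨h1, l, h2⟩ := hf t
    refine ⟨h1.congr_of_eventuallyEq (he.filter_mono nhdsWithin_le_nhds) he.eq_of_nhds, l, ?_⟩
    exact h2.congr' (he.filter_mono nhdsWithin_le_nhds).symm
  · have hτ : τ ≠ ⊤ := ne_top_of_le_ne_top WithTop.coe_ne_top h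
    lift τ to TimeInterval T using hτ
    have hle : τ ≤ t := WithTop.coe_le_coe.1 h
    constructor
    · refine (continuousWithinAt_const (b := f τ)).congr (fun s hs => ?_) ?_ <;>
        congr 1 <;> rw [← WithTop.coe_inj, coe_capTime, min_eq_right]
      · exact WithTop.coe_le_coe.2 (hle.trans hs)
      · exact h
    · rcases eq_or_lt_of_le hle with rfl | hlt
      · obtain ⟨-, l, h2⟩ := hf τ
        refine ⟨l, h2.congr' ?_⟩
        filter_upwards [self_mem_nhdsWithin] with s hs
        rw [capTime_eq_self (WithTop.coe_le_coe.2 (le_of_lt hs))]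
      · refine ⟨f τ, tendsto_const_nhds.congr' ?_⟩
        filter_upwards [nhdsWithin_le_nhds (eventually_ge_nhds hlt)] with s hs
        congr 1
        rw [← WithTop.coe_inj, coe_capTime, min_eq_right (WithTop.coe_le_coe.2 hs)]

variable {Ω : Type*} {mΩ : MeasurableSpace Ω} {P : Measure Ω} [IsProbabilityMeasure P]
  {𝓕 : Filtration (TimeInterval T) mΩ} {X Y : TimeInterval T → Ω → ℝ}

omit [IsProbabilityMeasure P] in
lemma IsCadlagProcess.stopped (hX : IsCadlagProcess X P) (τ : Ω → WithTop (TimeInterval T)) :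
    IsCadlagProcess (stoppedProcess X τ) P :=
  Filter.Eventually.mono hX fun ω hω => IsCadlagPath.capTime hω (τ ω)

omit [IsProbabilityMeasure P] in
/-- Fatou's lemma for real-valued functions. -/
lemma integrable_and_integral_le_of_tendsto_ae {f : ℕ → Ω → ℝ} {g : Ω → ℝ} {C : ℝ}
    (hf : ∀ n, Integrable (f n) P) (h0 : ∀ n, 0 ≤ᵐ[P] f n) (hC : ∀ n, ∫ ω, f n ω ∂P ≤ C)
    (hlim : ∀ᵐ ω ∂P, Tendsto (fun n => f n ω) atTop (𝓝 (g ω))) :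
    Integrable g P ∧ ∫ ω, g ω ∂P ≤ C := by
  have hgm : AEStronglyMeasurable g P :=
    aestronglyMeasurable_of_tendsto_ae atTop (fun n => (hf n).1) hlim
  have hg0 : 0 ≤ᵐ[P] g := by
    filter_upwards [ae_all_iff.2 h0, hlim] with ω h1 h2
    exact ge_of_tendsto' h2 h1
  have hle : ∫⁻ ω, ENNReal.ofReal (g ω) ∂P ≤ ENNReal.ofReal C :=
    calc ∫⁻ ω, ENNReal.ofReal (g ω) ∂P
        = ∫⁻ ω, liminf (fun n => ENNReal.ofReal (f n ω)) atTop ∂P := by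
          refine lintegral_congr_ae ?_
          filter_upwards [hlim] with ω hω
          exact ((ENNReal.continuous_ofReal.tendsto _).comp hω).liminf_eq.symm
      _ ≤ liminf (fun n => ∫⁻ ω, ENNReal.ofReal (f n ω) ∂P) atTop :=
          lintegral_liminf_le' fun n => (hf n).1.aemeasurable.ennreal_ofReal
      _ ≤ liminf (fun _ : ℕ => ENNReal.ofReal C) atTop := by
          refine liminf_le_liminf (Eventually.of_forall fun n => ?_)
          rw [← ofReal_integral_eq_lintegral_ofReal (hf n) (h0 n)]
          exact ENNReal.ofReal_le_ofReal (hC n)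
      _ = ENNReal.ofReal C := liminf_const _
  have hC0 : 0 ≤ C := (integral_nonneg_of_ae (h0 0)).trans (hC 0)
  refine ⟨⟨hgm, ?_⟩, ?_⟩
  · rw [hasFiniteIntegral_iff_ofReal hg0]
    exact hle.trans_lt ENNReal.ofReal_lt_top
  · rw [integral_eq_lintegral_of_nonneg_ae hg0 hgm]
    exact ENNReal.toReal_le_of_le_ofReal hC0 hle

/-! ### Optional sampling -/

/-- Optional sampling for càdlàg martingales on `[0, T]`. -/
lemma MeasureTheory.Martingale.integrable_and_integral_comp_eq (hX : Martingale X 𝓕 P)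
    (hc : IsCadlagProcess X P) {σ : Ω → TimeInterval T} (hσ : IsFiniteStoppingTime 𝓕 σ) :
    Integrable (fun ω => X (σ ω) ω) P ∧ ∫ ω, X (σ ω) ω ∂P = ∫ ω, X ⊥ ω ∂P := by
  let F : ℕ → Ω → ℝ := fun j ω => X (gridAbove j (σ ω)) ω
  -- Sampling at countably many times gives conditional expectations of the one variable `X ⊤`,
  -- hence uniform integrability and convergence in L¹.
  have hF : ∀ j, F j =ᵐ[P] P[X ⊤ | (hσ.gridAbove j).measurableSpace] := fun j => by
    refine hX.stoppedValue_ae_eq_condExp_of_le_const_of_countable_range (hσ.gridAbove j) (n := ⊤)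
      (fun ω => WithTop.coe_le_coe.2 le_top) ?_
    refine ((countable_range_gridAbove j).image
      (fun t : TimeInterval T => (t : WithTop (TimeInterval T)))).mono ?_
    rintro _ ⟨ω, rfl⟩
    exact ⟨_, ⟨_, rfl⟩, rfl⟩
  have hUI : UniformIntegrable F 1 P :=
    ((hX.integrable ⊤).uniformIntegrable_condExp
      fun j => (hσ.gridAbove j).measurableSpace_le).ae_eq fun j => (hF j).symm
  have hlim : ∀ᵐ ω ∂P, Tendsto (fun j => F j ω) atTop (𝓝 (X (σ ω) ω)) := by
    filter_upwards [hc] with ω hω using hω.tendsto_gridAbove (σ ω)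
  have hFi : ∀ j, Integrable (F j) P := fun j => integrable_condExp.congr (hF j).symm
  have hmem : MemLp (fun ω => X (σ ω) ω) 1 P := by
    refine ⟨aestronglyMeasurable_of_tendsto_ae atTop (fun j => (hFi j).1) hlim, ?_⟩
    obtain ⟨C, hC⟩ := hUI.2.2
    refine (Lp.eLpNorm_lim_le_liminf_eLpNorm (fun j => (hFi j).1) _ hlim).trans_lt ?_
    refine (liminf_le_liminf (Eventually.of_forall hC)).trans_lt ?_
    rw [liminf_const]
    exact ENNReal.coe_lt_top
  refine ⟨memLp_one_iff_integrable.1 hmem, ?_⟩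
  have h1 := tendsto_integral_of_L1' _ hmem.1 (Eventually.of_forall hFi)
    (tendsto_Lp_finite_of_tendsto_ae le_rfl ENNReal.one_ne_top (fun j => (hFi j).1) hmem hUI.2.1
      hlim)
  refine tendsto_nhds_unique h1 (tendsto_const_nhds.congr fun j => ?_)
  rw [integral_congr_ae (hF j), integral_condExp (hσ.gridAbove j).measurableSpace_le,
    ← integral_condExp (𝓕.le ⊥) (f := X ⊤)]
  exact (integral_congr_ae (hX.condExp_ae_eq bot_le)).symm

/-- An adapted process whose expectation is the same at all stopping times is a martingale. -/
lemma martingale_of_forall_integral_comp_eq (hX : StronglyAdapted 𝓕 X)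
    (hint : ∀ t, Integrable (X t) P)
    (h : ∀ σ : Ω → TimeInterval T, IsFiniteStoppingTime 𝓕 σ →
      ∫ ω, X (σ ω) ω ∂P = ∫ ω, X ⊥ ω ∂P) : Martingale X 𝓕 P := by
  classical
  refine ⟨hX, fun s t hst => ?_⟩
  refine (ae_eq_condExp_of_forall_setIntegral_eq (𝓕.le s) (hint t)
    (fun A _ _ => (hint s).integrableOn) (fun A hA _ => ?_)
    (hX s).aestronglyMeasurable).symm
  -- Comparing `σ` with the constant time `t` cancels the contribution of `Aᶜ` and leaves the
  -- identity on `A`.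
  let σ : Ω → TimeInterval T := A.piecewise (fun _ => s) (fun _ => t)
  have hσ : IsFiniteStoppingTime 𝓕 σ := by
    intro u
    simp only [WithTop.coe_le_coe]
    by_cases hu : s ≤ u
    · have : {ω | σ ω ≤ u} = A ∪ {_ω | t ≤ u} := by
        ext ω
        by_cases hω : ω ∈ A <;> simp [σ, hω, hu]
      rw [this]
      exact (𝓕.mono hu _ hA).union (MeasurableSet.const _)
    · have : {ω | σ ω ≤ u} = ∅ := by
        ext ω
        have hu' : ¬ t ≤ u := fun h => hu (hst.trans h)
        by_cases hω : ω ∈ A <;> simp [σ, hω, hu, hu']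
      rw [this]
      exact @MeasurableSet.empty _ (𝓕 u)
  have hA' : MeasurableSet A := 𝓕.le s _ hA
  have e1 : ∫ ω, X (σ ω) ω ∂P = ∫ ω in A, X s ω ∂P + ∫ ω in Aᶜ, X t ω ∂P := by
    have : (fun ω => X (σ ω) ω) = A.piecewise (X s) (X t) := by
      ext ω
      by_cases hω : ω ∈ A <;> simp [σ, hω]
    rw [this]
    exact integral_piecewise hA' (hint s).integrableOn (hint t).integrableOn
  have e2 := integral_add_compl hA' (hint t)
  have e3 := h σ hσ
  have e4 := h (fun _ => t) (isFiniteStoppingTime_const t)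
  linarith

/-- A stopped càdlàg martingale is a martingale. -/
lemma MeasureTheory.Martingale.stopped (h𝓕 : UsualAssumptions 𝓕 P) (hX : Martingale X 𝓕 P)
    (hc : IsCadlagProcess X P) {τ : Ω → WithTop (TimeInterval T)} (hτ : IsStoppingTime 𝓕 τ) :
    Martingale (stoppedProcess X τ) 𝓕 P := by
  refine martingale_of_forall_integral_comp_eq
    (h𝓕.stronglyAdapted_stoppedProcess hX.stronglyAdapted hc hτ) (fun t => ?_) fun σ hσ => ?_
  · exact (hX.integrable_and_integral_comp_eq hc (hτ.capTime (isFiniteStoppingTime_const t))).1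
  · simp only [stoppedProcess_eq_capTime, capTime_bot]
    exact (hX.integrable_and_integral_comp_eq hc (hτ.capTime hσ)).2

/-! ### Local martingales -/

/-- The minimum of the two localizing sequences works for both processes, since a stopped martingale
stays a martingale when stopped again. -/
lemma IsLocalMartingale.sub (h𝓕 : UsualAssumptions 𝓕 P) (hX : IsLocalMartingale X 𝓕 P)
    (hY : IsLocalMartingale Y 𝓕 P) : IsLocalMartingale (X - Y) 𝓕 P := by
  obtain ⟨hXa, hXc, τ, hτ, hXτ⟩ := hX
  obtain ⟨hYa, hYc, ρ, hρ, hYρ⟩ := hY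
  refine ⟨hXa.sub hYa, ?_, min τ ρ, hτ.min hρ, fun k => ?_⟩
  · filter_upwards [hXc, hYc] with ω h1 h2 using h1.sub h2
  have e : stoppedProcess (X - Y) ((min τ ρ) k) =
      stoppedProcess (stoppedProcess X (τ k)) (ρ k) -
        stoppedProcess (stoppedProcess Y (ρ k)) (τ k) := by
    rw [stoppedProcess_stoppedProcess, stoppedProcess_stoppedProcess, inf_comm (ρ k)]
    rfl
  rw [e]
  exact ((hXτ k).stopped h𝓕 (hXc.stopped _) (hρ.isStoppingTime k)).sub
    ((hYρ k).stopped h𝓕 (hYc.stopped _) (hτ.isStoppingTime k))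

omit [IsProbabilityMeasure P] in
lemma IsLocalMartingale.integrable_bot (hX : IsLocalMartingale X 𝓕 P) : Integrable (X ⊥) P := by
  obtain ⟨-, -, τ, -, hXτ⟩ := hX
  refine ((hXτ 0).integrable ⊥).congr (Eventually.of_forall fun ω => ?_)
  rw [stoppedProcess_eq_capTime, capTime_bot]

omit [IsProbabilityMeasure P] in
lemma ProbabilityTheory.IsLocalizingSequence.ae_eventually_capTime_eq
    {τ : ℕ → Ω → WithTop (TimeInterval T)} (hτ : IsLocalizingSequence 𝓕 τ P) :
    ∀ᵐ ω ∂P, ∀ t, ∀ᶠ k in atTop, capTime (τ k ω) t = t := by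
  filter_upwards [hτ.tendsto_top] with ω hω t
  filter_upwards [(WithTop.tendsto_nhds_top_iff _).1 hω t] with k hk
  exact capTime_eq_self hk.le

/-- A nonnegative local martingale satisfies the supermartingale inequality at stopping times. -/
lemma IsLocalMartingale.integrable_and_integral_comp_le (hX : IsLocalMartingale X 𝓕 P)
    (h0 : ∀ t, ∀ᵐ ω ∂P, 0 ≤ X t ω) {σ : Ω → TimeInterval T} (hσ : IsFiniteStoppingTime 𝓕 σ) :
    Integrable (fun ω => X (σ ω) ω) P ∧ ∫ ω, X (σ ω) ω ∂P ≤ ∫ ω, X ⊥ ω ∂P := by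
  obtain ⟨-, hc, τ, hτ, hXτ⟩ := hX
  have hs := fun k => (hXτ k).integrable_and_integral_comp_eq (hc.stopped (τ k)) hσ
  simp only [stoppedProcess_eq_capTime, capTime_bot] at hs
  -- Fatou along the localizing sequence turns the equalities into an inequality.
  refine integrable_and_integral_le_of_tendsto_ae (fun k => (hs k).1) (fun k => ?_)
    (fun k => (hs k).2.le) ?_
  · filter_upwards [hc.ae_nonneg h0] with ω hω using hω _
  · filter_upwards [hτ.ae_eventually_capTime_eq] with ω hω
    refine tendsto_const_nhds.congr' ?_
    filter_upwards [hω (σ ω)] with k hk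
    rw [hk]

/-- A local martingale that is dominated before the stopping time `σ` satisfies the martingale
equality at `σ`. -/
lemma IsLocalMartingale.integral_comp_eq_of_dominated (hX : IsLocalMartingale X 𝓕 P)
    {σ : Ω → TimeInterval T} (hσ : IsFiniteStoppingTime 𝓕 σ) {D : Ω → ℝ} (hD : Integrable D P)
    (hXD : ∀ᵐ ω ∂P, ∀ t ≤ σ ω, |X t ω| ≤ D ω) : ∫ ω, X (σ ω) ω ∂P = ∫ ω, X ⊥ ω ∂P := by
  obtain ⟨-, hc, τ, hτ, hXτ⟩ := hX
  have hs := fun k => (hXτ k).integrable_and_integral_comp_eq (hc.stopped (τ k)) hσ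
  simp only [stoppedProcess_eq_capTime, capTime_bot] at hs
  refine tendsto_nhds_unique (tendsto_integral_of_dominated_convergence D
    (fun k => (hs k).1.1) hD (fun k => ?_) ?_) (tendsto_const_nhds.congr fun k => (hs k).2.symm)
  · filter_upwards [hXD] with ω hω using hω _ (capTime_le _ _)
  · filter_upwards [hτ.ae_eventually_capTime_eq] with ω hω
    refine tendsto_const_nhds.congr' ?_
    filter_upwards [hω (σ ω)] with k hk
    rw [hk]

end Stopped

/-! ### Exceedance times -/

noncomputable instance TimeInterval.instInhabited {T : ℝ≥0} : Inhabited (TimeInterval T) := ⟨⊥⟩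

/-- The first time at which the process `X` exceeds the level `c`. -/
noncomputable def exceedTime {T : ℝ≥0} {Ω : Type*} (X : TimeInterval T → Ω → ℝ) (c : ℝ) :
    Ω → WithTop (TimeInterval T) :=
  hittingAfter X (Set.Ioi c) ⊥

section Exceed

variable {T : ℝ≥0} {Ω : Type*} {X : TimeInterval T → Ω → ℝ} {c : ℝ} {ω : Ω}

lemma le_of_lt_exceedTime {t : TimeInterval T} (h : t < exceedTime X c ω) : X t ω ≤ c :=
  not_lt.1 (notMem_of_lt_hittingAfter h bot_le)

lemma exceedTime_lt_iff {t : TimeInterval T} : exceedTime X c ω < t ↔ ∃ s < t, c < X s ω := by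
  rw [exceedTime, hittingAfter_lt_iff]
  simp

lemma exceedTime_eq_top_iff : exceedTime X c ω = ⊤ ↔ ∀ t, X t ω ≤ c := by
  rw [exceedTime, hittingAfter_eq_top_iff]
  simp

lemma exceedTime_mono : Monotone (fun c => exceedTime X c ω) := fun _ _ h =>
  hittingAfter_anti X ⊥ (Set.Ioi_subset_Ioi h) ω

/-- The infimum need not be attained, but a value below `c` would, by right-continuity, postpone the
exceedance. At `T` there is no later time, so an actual exceedance is used there. -/
lemma IsCadlagPath.le_of_exceedTime_eq (hω : IsCadlagPath fun t => X t ω) {t : TimeInterval T}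
    (h : exceedTime X c ω = t) : c ≤ X t ω := by
  by_contra! hlt
  have hev := (hω t).1.tendsto.eventually (eventually_lt_nhds hlt)
  rcases eq_or_lt_of_le (le_top : t ≤ ⊤) with rfl | ht
  · have hne : exceedTime X c ω ≠ ⊤ := by rw [h]; exact WithTop.coe_ne_top
    rw [Ne, exceedTime_eq_top_iff] at hne
    push Not at hne
    obtain ⟨s, hs⟩ := hne
    rcases eq_or_lt_of_le (le_top : s ≤ ⊤) with rfl | hs'
    · exact lt_asymm hs hlt
    · have := exceedTime_lt_iff.2 ⟨s, hs', hs⟩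
      exact this.ne h
  · obtain ⟨u, hu, hsub⟩ := (mem_nhdsGE_iff_exists_Ico_subset' ht).1 hev
    have h1 : exceedTime X c ω < u := by rw [h]; exact WithTop.coe_lt_coe.2 hu
    obtain ⟨s, hsu, hs⟩ := exceedTime_lt_iff.1 h1
    rcases lt_or_ge s t with hst | hts
    · exact (exceedTime_lt_iff.2 ⟨s, hst, hs⟩).ne h
    · exact lt_asymm hs (hsub ⟨hts, hsu⟩)

variable {mΩ : MeasurableSpace Ω} {P : Measure Ω} {𝓕 : Filtration (TimeInterval T) mΩ}

lemma UsualAssumptions.measurableSet_congr (h : UsualAssumptions 𝓕 P) {t : TimeInterval T}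
    {A B : Set Ω} (hA : MeasurableSet[𝓕 t] A) (hAB : ∀ᵐ ω ∂P, ω ∈ A ↔ ω ∈ B) :
    MeasurableSet[𝓕 t] B := by
  classical
  have h1 : Measurable[𝓕 t] (B.indicator (fun _ => (1 : ℝ))) := by
    refine h.measurable_of_ae_eq (f := A.indicator (fun _ => (1 : ℝ)))
      ((@measurable_const _ _ _ (𝓕 t) 1).indicator hA) ?_
    filter_upwards [hAB] with ω hω
    by_cases hA : ω ∈ A
    · simp [hA, hω.1 hA]
    · simp [hA, mt hω.2 hA]
  have h2 : B = B.indicator (fun _ => (1 : ℝ)) ⁻¹' {1} := by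
    ext ω
    by_cases hω : ω ∈ B <;> simp [hω]
  rw [h2]
  exact h1 (measurableSet_singleton 1)

/-- The exceedance times of an adapted càdlàg process are stopping times. -/
lemma UsualAssumptions.isStoppingTime_exceedTime (h : UsualAssumptions 𝓕 P)
    (hX : StronglyAdapted 𝓕 X) (hc : IsCadlagProcess X P) (c : ℝ) :
    IsStoppingTime 𝓕 (exceedTime X c) := by
  have := h.rightContinuous
  have hlt : ∀ t, MeasurableSet[𝓕 t] {ω | exceedTime X c ω < t} := fun t => by
    -- By right-continuity an exceedance before `t` is also seen at a grid point before `t`.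
    refine h.measurableSet_congr (A := ⋃ q ∈ gridPoints T ∩ Set.Iio t, {ω | c < X q ω}) ?_ ?_
    · refine MeasurableSet.biUnion (countable_gridPoints.mono Set.inter_subset_left) fun q hq => ?_
      exact 𝓕.mono (le_of_lt hq.2) _ ((hX q).measurable measurableSet_Ioi)
    · filter_upwards [hc] with ω hω
      simp only [Set.mem_iUnion, Set.mem_ofPred_eq, exceedTime_lt_iff]
      constructor
      · rintro ⟨q, hq, hqc⟩
        exact ⟨q, hq.2, hqc⟩
      · rintro ⟨s, hst, hs⟩
        have e1 := (hω.tendsto_gridAbove s).eventually (eventually_gt_nhds hs)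
        have e2 := ((tendsto_gridAbove s).mono_right nhdsWithin_le_nhds).eventually
          (eventually_lt_nhds hst)
        obtain ⟨j, h1, h2⟩ := (e1.and e2).exists
        exact ⟨_, ⟨gridAbove_mem_gridPoints j s, h2⟩, h1⟩
  -- Right-continuity of the filtration settles all times except those with nothing to their right,
  -- that is `T`, where the event of equality is treated by hand.
  refine isStoppingTime_of_measurableSet_lt_of_isRightContinuous' hlt fun t ht => ?_
  have ht' : t = ⊤ := by
    by_contra hne
    have := nhdsGT_neBot_of_exists_gt ⟨⊤, lt_top_iff_ne_top.2 hne⟩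
    exact this.ne ht
  subst ht'
  have hfin : MeasurableSet[𝓕 ⊤] {ω | exceedTime X c ω ≠ ⊤} := by
    refine h.measurableSet_congr (A := ⋃ q ∈ gridPoints T, {ω | c < X q ω}) ?_ ?_
    · refine MeasurableSet.biUnion countable_gridPoints fun q _ => ?_
      exact 𝓕.mono le_top _ ((hX q).measurable measurableSet_Ioi)
    · filter_upwards [hc] with ω hω
      simp only [Set.mem_iUnion, Set.mem_ofPred_eq, Ne, exceedTime_eq_top_iff, not_forall, not_le]
      constructor
      · rintro ⟨q, _, hqc⟩
        exact ⟨q, hqc⟩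
      · rintro ⟨s, hs⟩
        obtain ⟨j, h1⟩ :=
          ((hω.tendsto_gridAbove s).eventually (eventually_gt_nhds hs)).exists
        exact ⟨_, gridAbove_mem_gridPoints j s, h1⟩
  have : {ω | exceedTime X c ω = ((⊤ : TimeInterval T) : WithTop (TimeInterval T))} =
      {ω | exceedTime X c ω ≠ ⊤} \
        {ω | exceedTime X c ω < ((⊤ : TimeInterval T) : WithTop (TimeInterval T))} := by
    ext ω
    simp only [Set.mem_ofPred_eq, Set.mem_sdiff, not_lt]
    constructor
    · intro h
      rw [h]
      exact ⟨WithTop.coe_ne_top, le_rfl⟩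
    · rintro ⟨h1, h2⟩
      obtain ⟨s, hs⟩ := WithTop.ne_top_iff_exists.1 h1
      rw [← hs] at h2 ⊢
      exact congrArg _ (top_le_iff.1 (WithTop.coe_le_coe.1 h2))
  rw [this]
  exact hfin.diff (hlt ⊤)

/-- Every càdlàg path is bounded by `c` plus its value at the exceedance time, up to that time. -/
lemma le_add_of_le_exceedTime {t : TimeInterval T} (hc : 0 ≤ c) (h0 : ∀ t, 0 ≤ X t ω)
    (ht : t ≤ exceedTime X c ω) : X t ω ≤ c + X (capTime (exceedTime X c ω) ⊤) ω := by
  rcases eq_or_lt_of_le ht with h | h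
  · have : capTime (exceedTime X c ω) ⊤ = t := by
      rw [← WithTop.coe_inj, coe_capTime, ← h, min_eq_right (WithTop.coe_le_coe.2 le_top)]
    rw [this]
    linarith
  · linarith [le_of_lt_exceedTime h, h0 (capTime (exceedTime X c ω) ⊤)]

/-- The exceedance times of the levels `k : ℕ` are a localizing sequence. -/
lemma UsualAssumptions.isLocalizingSequence_exceedTime (h : UsualAssumptions 𝓕 P)
    (hX : StronglyAdapted 𝓕 X) (hc : IsCadlagProcess X P) :
    IsLocalizingSequence 𝓕 (fun k : ℕ => exceedTime X k) P where
  isStoppingTime k := h.isStoppingTime_exceedTime hX hc k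
  tendsto_top := by
    filter_upwards [hc] with ω hω
    obtain ⟨C, hC⟩ := hω.bddAbove
    refine tendsto_const_nhds.congr' ?_
    filter_upwards [eventually_ge_atTop ⌈C⌉₊] with k hk
    exact (exceedTime_eq_top_iff.2 fun t =>
      (hC t).trans ((Nat.le_ceil C).trans (by exact_mod_cast hk))).symm
  mono := ae_of_all _ fun ω j k hjk => exceedTime_mono (ω := ω) (by exact_mod_cast hjk)

/-- Doob's maximal inequality for nonnegative local martingales. -/
lemma IsLocalMartingale.measure_exists_lt_le [IsProbabilityMeasure P] (h𝓕 : UsualAssumptions 𝓕 P)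
    (hX : IsLocalMartingale X 𝓕 P) (h0 : ∀ t, ∀ᵐ ω ∂P, 0 ≤ X t ω) {ε : ℝ} (hε : 0 < ε) :
    P {ω | ∃ t, ε < X t ω} ≤ ENNReal.ofReal ((∫ ω, X ⊥ ω ∂P) / ε) := by
  have hτ := h𝓕.isStoppingTime_exceedTime hX.1 hX.2.1 ε
  obtain ⟨hint, hle⟩ :=
    hX.integrable_and_integral_comp_le h0 (hτ.capTime (isFiniteStoppingTime_const ⊤))
  have hnn : 0 ≤ᵐ[P] fun ω => X (capTime (exceedTime X ε ω) ⊤) ω := by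
    filter_upwards [hX.2.1.ae_nonneg h0] with ω hω using hω _
  have hmark := mul_meas_ge_le_integral_of_nonneg hnn hint ε
  -- An exceedance forces the value at the exceedance time to be at least `ε`, so Markov's
  -- inequality at this single stopping time suffices.
  have hsub : P {ω | ∃ t, ε < X t ω} ≤ P {ω | ε ≤ X (capTime (exceedTime X ε ω) ⊤) ω} := by
    refine measure_mono_ae ?_
    filter_upwards [hX.2.1] with ω hω
    rintro ⟨t, ht⟩
    have hne : exceedTime X ε ω ≠ ⊤ := fun h => not_lt.2 (exceedTime_eq_top_iff.1 h t) ht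
    obtain ⟨s, hs⟩ := WithTop.ne_top_iff_exists.1 hne
    have e : capTime (exceedTime X ε ω) ⊤ = s := by
      rw [← WithTop.coe_inj, coe_capTime, ← hs, min_eq_right (WithTop.coe_le_coe.2 le_top)]
    change ε ≤ X (capTime (exceedTime X ε ω) ⊤) ω
    rw [e]
    exact hω.le_of_exceedTime_eq hs.symm
  refine hsub.trans ?_
  rw [← ofReal_measureReal]
  refine ENNReal.ofReal_le_ofReal ?_
  rw [le_div_iff₀ hε, mul_comm]
  exact hmark.trans hle

end Exceed

/-! ### Monotone sequences of local martingales -/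

section Monotone

variable {T : ℝ≥0} {Ω : Type*} {mΩ : MeasurableSpace Ω} {P : Measure Ω} [IsProbabilityMeasure P]
  {𝓕 : Filtration (TimeInterval T) mΩ}

lemma tendstoUniformly_of_eventually_dist_le_geometric {α : Type*} {F : ℕ → α → ℝ}
    (h : ∀ᶠ k in atTop, ∀ t, dist (F k t) (F (k + 1) t) ≤ (1 / 2) ^ k) :
    TendstoUniformly F (fun t => limUnder atTop fun k => F k t) atTop := by
  obtain ⟨K, hK⟩ := eventually_atTop.1 h
  -- Geometric steps with constant `2 * (1 / 2) ^ k`, which also bounds the distance of `F k` to the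
  -- limit, uniformly in `t`.
  have hstep : ∀ k ≥ K, ∀ t n, dist (F (n + k) t) (F (n + 1 + k) t) ≤
      (2 * (1 / 2) ^ k) / 2 / 2 ^ n := fun k hk t n => by
    have := hK (n + k) (by omega) t
    rw [show n + 1 + k = n + k + 1 by ring]
    refine this.trans (le_of_eq ?_)
    rw [pow_add]
    simp only [one_div, inv_pow]
    field_simp
  have hlim : ∀ t, Tendsto (fun k => F k t) atTop (𝓝 (limUnder atTop fun k => F k t)) := fun t => by
    have hc := cauchySeq_of_le_geometric_two (hstep K le_rfl t)
    obtain ⟨l, hl⟩ := cauchySeq_tendsto_of_complete hc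
    exact tendsto_nhds_limUnder ⟨l, (tendsto_add_atTop_iff_nat K).1 hl⟩
  rw [Metric.tendstoUniformly_iff]
  intro ε hε
  have hsmall : Tendsto (fun k : ℕ => 2 * (1 / 2 : ℝ) ^ k) atTop (𝓝 (2 * 0)) :=
    (tendsto_pow_atTop_nhds_zero_of_lt_one (by norm_num) (by norm_num)).const_mul 2
  rw [mul_zero] at hsmall
  filter_upwards [hsmall.eventually (gt_mem_nhds hε), eventually_ge_atTop K] with k hk hkK t
  rw [dist_comm]
  refine lt_of_le_of_lt ?_ hk
  have := dist_le_of_le_geometric_two_of_tendsto₀ (hstep k hkK t)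
    ((tendsto_add_atTop_iff_nat k).2 (hlim t))
  simpa using this

/-- An increasing sequence of nonnegative local martingales whose initial values increase to an
integrable limit has an almost surely uniformly convergent subsequence. -/
lemma exists_subseq_ae_tendstoUniformly (h𝓕 : UsualAssumptions 𝓕 P)
    {M : ℕ → TimeInterval T → Ω → ℝ} (hM : ∀ n, IsLocalMartingale (M n) 𝓕 P)
    (hmono : ∀ t, ∀ᵐ ω ∂P, Monotone fun n => M n t ω) {a : ℝ}
    (hle : ∀ n, ∫ ω, M n ⊥ ω ∂P ≤ a)
    (ha : Tendsto (fun n => ∫ ω, M n ⊥ ω ∂P) atTop (𝓝 a)) :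
    ∃ φ : ℕ → ℕ, StrictMono φ ∧ ∀ᵐ ω ∂P, TendstoUniformly (fun k t => M (φ k) t ω)
      (fun t => limUnder atTop fun k => M (φ k) t ω) atTop := by
  -- Gaps `4⁻ᵏ` against thresholds `2⁻ᵏ` leave probabilities `2⁻ᵏ`, summable for Borel–Cantelli.
  obtain ⟨φ, hφ, hφa⟩ := extraction_forall_of_eventually
    (P := fun k n => a - ∫ ω, M n ⊥ ω ∂P < (1 / 4) ^ k) fun k => by
      have h1 : (0 : ℝ) < (1 / 4) ^ k := by positivity
      filter_upwards [ha.eventually (lt_mem_nhds (sub_lt_self a h1))] with n hn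
      linarith
  refine ⟨φ, hφ, ?_⟩
  have hstep : ∀ k, P {ω | ∃ t, (1 / 2) ^ k < (M (φ (k + 1)) - M (φ k)) t ω} ≤
      ENNReal.ofReal ((1 / 2) ^ k) := fun k => by
    refine (((hM (φ (k + 1))).sub h𝓕 (hM (φ k))).measure_exists_lt_le h𝓕 (fun t => ?_)
      (by positivity)).trans (ENNReal.ofReal_le_ofReal ?_)
    · filter_upwards [hmono t] with ω hω
      exact sub_nonneg.2 (hω (hφ.monotone k.le_succ))
    · rw [div_le_iff₀ (by positivity), ← mul_pow]
      norm_num only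
      simp only [Pi.sub_apply]
      rw [integral_sub (hM _).integrable_bot (hM _).integrable_bot]
      have := hle (φ (k + 1))
      have := (hφa k).le
      linarith
  have hsum : ∑' k, P {ω | ∃ t, (1 / 2) ^ k < (M (φ (k + 1)) - M (φ k)) t ω} ≠ ⊤ := by
    refine ne_top_of_le_ne_top ?_ (ENNReal.tsum_le_tsum hstep)
    rw [← ENNReal.ofReal_tsum_of_nonneg (fun _ => by positivity) summable_geometric_two]
    exact ENNReal.ofReal_ne_top
  have hmono' : ∀ᵐ ω ∂P, ∀ k t, M (φ k) t ω ≤ M (φ (k + 1)) t ω :=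
    ae_all_iff.2 fun k => (hM _).2.1.ae_le (hM _).2.1 fun t =>
      (hmono t).mono fun ω hω => hω (hφ.monotone k.le_succ)
  filter_upwards [ae_eventually_notMem hsum, hmono'] with ω h1 h2
  refine tendstoUniformly_of_eventually_dist_le_geometric (F := fun k t => M (φ k) t ω) ?_
  filter_upwards [h1] with k hk t
  simp only [not_exists, not_lt, Pi.sub_apply] at hk
  rw [dist_comm, Real.dist_eq, abs_of_nonneg (sub_nonneg.2 (h2 k t))]
  exact hk t

/-- A càdlàg process dominating a sequence of nonnegative local martingales which converges to it
along a subsequence, simultaneously at all times, is a local martingale. -/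
lemma isLocalMartingale_of_tendsto (h𝓕 : UsualAssumptions 𝓕 P)
    {M : ℕ → TimeInterval T → Ω → ℝ} {Y : TimeInterval T → Ω → ℝ}
    (hM : ∀ n, IsLocalMartingale (M n) 𝓕 P) (h0 : ∀ n t, ∀ᵐ ω ∂P, 0 ≤ M n t ω)
    (hY : IsCadlagProcess Y P) (hle : ∀ n t, ∀ᵐ ω ∂P, M n t ω ≤ Y t ω)
    (hlim : ∀ᵐ ω ∂P, ∀ t, Tendsto (fun n => M n t ω) atTop (𝓝 (Y t ω)))
    (hint : Integrable (Y ⊥) P) : IsLocalMartingale Y 𝓕 P := by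
  have hYa : StronglyAdapted 𝓕 Y := fun t =>
    (h𝓕.measurable_of_tendsto_ae (fun n => ((hM n).1 t).measurable)
      (hlim.mono fun ω hω => hω t)).stronglyMeasurable
  have h0' : ∀ᵐ ω ∂P, ∀ n t, 0 ≤ M n t ω := ae_all_iff.2 fun n => (hM n).2.1.ae_nonneg (h0 n)
  have hle' : ∀ᵐ ω ∂P, ∀ n t, M n t ω ≤ Y t ω :=
    ae_all_iff.2 fun n => (hM n).2.1.ae_le hY (hle n)
  have hsup : ∀ σ : Ω → TimeInterval T, IsFiniteStoppingTime 𝓕 σ →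
      Integrable (fun ω => Y (σ ω) ω) P ∧ ∫ ω, Y (σ ω) ω ∂P ≤ ∫ ω, Y ⊥ ω ∂P := fun σ hσ => by
    have h1 := fun n => (hM n).integrable_and_integral_comp_le (h0 n) hσ
    refine integrable_and_integral_le_of_tendsto_ae (fun n => (h1 n).1) (fun n => ?_)
      (fun n => (h1 n).2.trans (integral_mono_ae (hM n).integrable_bot hint (hle n ⊥))) ?_
    · filter_upwards [h0'] with ω hω using hω _ _
    · filter_upwards [hlim] with ω hω using hω _
  have hbot : Tendsto (fun n => ∫ ω, M n ⊥ ω ∂P) atTop (𝓝 (∫ ω, Y ⊥ ω ∂P)) := by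
    refine tendsto_integral_of_dominated_convergence (Y ⊥) (fun n => (hM n).integrable_bot.1) hint
      (fun n => ?_) (hlim.mono fun ω hω => hω ⊥)
    filter_upwards [h0', hle'] with ω h1 h2
    rw [Real.norm_of_nonneg (h1 n ⊥)]
    exact h2 n ⊥
  refine ⟨hYa, hY, fun k : ℕ => exceedTime Y k, h𝓕.isLocalizingSequence_exceedTime hYa hY,
    fun k => ?_⟩
  have hτ := h𝓕.isStoppingTime_exceedTime hYa hY (k : ℝ)
  refine martingale_of_forall_integral_comp_eq
    (h𝓕.stronglyAdapted_stoppedProcess hYa hY hτ) (fun t => ?_) fun σ hσ => ?_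
  · exact (hsup _ (hτ.capTime (isFiniteStoppingTime_const t))).1
  simp only [stoppedProcess_eq_capTime, capTime_bot]
  have hρ := hτ.capTime hσ
  -- The lower bound: each `M n` is dominated up to the exceedance time of `Y`, so its expectation
  -- at the capped time equals that at 0.
  refine le_antisymm (hsup _ hρ).2 (le_of_tendsto' hbot fun n => ?_)
  rw [← (hM n).integral_comp_eq_of_dominated hρ
    ((integrable_const (k : ℝ)).add (hsup _ (hτ.capTime (isFiniteStoppingTime_const ⊤))).1) ?_]
  · refine integral_mono_ae ((hM n).integrable_and_integral_comp_le (h0 n) hρ).1 (hsup _ hρ).1 ?_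
    filter_upwards [hle'] with ω hω using hω n _
  · filter_upwards [h0', hle'] with ω h1 h2 t ht
    rw [abs_of_nonneg (h1 n t)]
    refine (h2 n t).trans (le_add_of_le_exceedTime k.cast_nonneg
      (fun s => (h1 n s).trans (h2 n s)) ?_)
    refine (WithTop.coe_le_coe.2 ht).trans ?_
    rw [coe_capTime]
    exact min_le_right _ _

end Monotone

theorem proposition5p3 {Ω : Type*} {mΩ : MeasurableSpace Ω} (P : Measure Ω)
    [IsProbabilityMeasure P] (T : ℝ≥0) (𝓕 : Filtration (TimeInterval T) mΩ)
    (h𝓕 : UsualAssumptions 𝓕 P)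
    (M : ℕ → TimeInterval T → Ω → ℝ) (Mlim : TimeInterval T → Ω → ℝ)
    (hM : ∀ n, IsLocalMartingale (M n) 𝓕 P)
    (hM_nonneg : ∀ n t, ∀ᵐ ω ∂P, 0 ≤ M n t ω)
    (hM_mono : ∀ n t, ∀ᵐ ω ∂P, M n t ω ≤ M (n + 1) t ω)
    (hM_lim : ∀ t, ∀ᵐ ω ∂P, Tendsto (fun n => M n t ω) atTop (𝓝 (Mlim t ω)))
    (hM_zero : Integrable (Mlim ⊥) P) :
    (∃ Y : TimeInterval T → Ω → ℝ, IsCadlagModification Y Mlim P) ∧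
      ∀ Y : TimeInterval T → Ω → ℝ, IsCadlagModification Y Mlim P → IsLocalMartingale Y 𝓕 P := by
  have hmono : ∀ t, ∀ᵐ ω ∂P, Monotone fun n => M n t ω := fun t => by
    filter_upwards [ae_all_iff.2 fun n => hM_mono n t] with ω hω using monotone_nat_of_le_succ hω
  have hle : ∀ n t, ∀ᵐ ω ∂P, M n t ω ≤ Mlim t ω := fun n t => by
    filter_upwards [hmono t, hM_lim t] with ω h1 h2 using h1.ge_of_tendsto h2 n
  -- Monotone convergence at time 0, using `E[M_0] < ∞`.
  have hbot : Tendsto (fun n => ∫ ω, M n ⊥ ω ∂P) atTop (𝓝 (∫ ω, Mlim ⊥ ω ∂P)) :=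
    integral_tendsto_of_tendsto_of_monotone (fun n => (hM n).integrable_bot) hM_zero (hmono ⊥)
      (hM_lim ⊥)
  obtain ⟨φ, hφ, hunif⟩ := exists_subseq_ae_tendstoUniformly h𝓕 hM hmono
    (fun n => integral_mono_ae (hM n).integrable_bot hM_zero (hle n ⊥)) hbot
  let Z : TimeInterval T → Ω → ℝ := fun t ω => limUnder atTop fun k => M (φ k) t ω
  have hZ : IsCadlagModification Z Mlim P := by
    constructor
    · filter_upwards [ae_all_iff.2 fun n => (hM n).2.1, hunif] with ω h1 h2
      exact .of_tendstoUniformly (fun k => h1 (φ k)) h2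
    · intro t
      filter_upwards [hunif, hM_lim t] with ω h1 h2
      exact tendsto_nhds_unique (h1.tendsto_at t) (h2.comp hφ.tendsto_atTop)
  refine ⟨⟨Z, hZ⟩, fun Y hY => ?_⟩
  have hYZ : ∀ t, Y t =ᵐ[P] Z t := fun t => (hY.2 t).trans (hZ.2 t).symm
  refine isLocalMartingale_of_tendsto h𝓕 (M := fun k => M (φ k)) (fun k => hM _)
    (fun k => hM_nonneg _) hY.1 (fun k t => ?_) ?_ (hM_zero.congr (hY.2 ⊥).symm)
  · filter_upwards [hle (φ k) t, hY.2 t] with ω h1 h2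
    rwa [h2]
  -- Two càdlàg modifications are indistinguishable, so `Y` inherits the simultaneous convergence to
  -- `Z`.
  · filter_upwards [hY.1.ae_le hZ.1 fun t => (hYZ t).le, hZ.1.ae_le hY.1 fun t => (hYZ t).symm.le,
      hunif] with ω h1 h2 h3 t
    rw [le_antisymm (h1 t) (h2 t)]
    exact h3.tendsto_at t
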